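/- Let $A(x)=1+\sum_{n\ge 1}a_nx^n$ and $y(x)=\sum_{n\ge 1}y_nx^n$ be power series with real coefficients, with radii of convergence $R,r\in[0,\infty]$ respectively. Assume that $R>0$, that $a_n\ge 0$ for all $n\ge 1$, that $y(x)=xA(y(x))$ as formal power series, and that $\gcd\{n\ge 1: a_n>0\}=1$. (The coefficients $y_n$ are then non-negative, and $y(r)\in[0,\infty]$ denotes the sum $\sum_{n\ge1}y_nr^n$.) Then exactly one of the following is true: (1) $A(z)-zA'(z)\neq 0$ for all $z\in(0,R)$, in which case $R=y(r)$ (both may be $\infty$); (2) $R>y(r)=\tau$, where $\tau$ is the unique solution of $A(\tau)-\tau A'(\tau)=0$ in $(0,R)$, and there is a constant $C>0$ such that $y_n=C\,r^{-n}n^{-3/2}(1+o(1))$ as $n\to\infty$. -/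

import Mathlib

open Filter Topology Asymptotics PowerSeries
open scoped ENNReal

noncomputable section

namespace TreeSeries

/-- The radius of convergence, in `[0, ∞]`, of a formal power series with real coefficients. -/
def radius (f : PowerSeries ℝ) : ℝ≥0∞ :=
  (FormalMultilinearSeries.ofScalars ℝ (fun n => coeff n f)).radius

/-- The sum `∑ fₙ zⁿ` as a function of a real variable; it is used only for `|z| < radius f`. -/
def fn (f : PowerSeries ℝ) (z : ℝ) : ℝ :=
  ∑' n : ℕ, coeff n f * z ^ n

/-- The value `∑ fₙ tⁿ` in `[0, ∞]`, at `t` in `[0, ∞]`, of a series all of whose coefficients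
are non-negative; it is `∞` if the series diverges. (It is used only for the solution `y` of
`y = x A(y)`, where `A` has non-negative coefficients, so that `y` has them too.) -/
def value (f : PowerSeries ℝ) (t : ℝ≥0∞) : ℝ≥0∞ :=
  ∑' n : ℕ, ENNReal.ofReal (coeff n f) * t ^ n

/-- The interval `(0, ρ)` of the real line, where `ρ` may be `∞`. -/
def openInterval (ρ : ℝ≥0∞) : Set ℝ :=
  {z : ℝ | 0 < z ∧ ENNReal.ofReal z < ρ}

/-- The function `z ↦ A(z) - z A'(z)`. -/
def charFn (A : PowerSeries ℝ) (z : ℝ) : ℝ :=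
  fn A z - z * deriv (fn A) z

end TreeSeries

end

noncomputable section

namespace TreeSeries

/-! On `(0, R)` the function `φ(z) = z / A(z)` has derivative `(A - z A') / A²`, and `φ(y(x)) = x`
wherever `0 < x` and `y(x)` is finite. All values are taken in `[0, ∞]`, where `y(x)` is the least
solution of `z = x A(z)` (`value_solution`, `value_solution_le`); hence `y(φ(z)) = w ≤ z` with `φ(w)
= φ(z)`. Without a critical point, Rolle forces `w = z`, so `y(r) ≥ R`; conversely, finiteness of
`y(x)` forces `A` to converge there, so `y(r) ≤ R`. At a critical point `τ`, which is unique, the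
tangent to `A` passes through the origin, so `φ` is maximal at `τ`; thus `r = φ(τ)` and `y(r) = τ`.

The asymptotics need no singularity analysis of `y`. By Lagrange inversion `n y_n = [x^(n-1)] A^n`.
The weights `a_k τ^k / A(τ)` form a probability law, of mean 1 because `τ` is critical, and the
normalised coefficient is the probability that `n` independent copies sum to `n - 1`. Fourier
inversion and Laplace's method show that it is of order `n^(-1/2)`; the gcd condition, with `a_0 =
1`, supplies aperiodicity. -/

/-! ### Formal substitution and Lagrange inversion. -/

lemma coeff_pow_eq_zero_of_lt {y : PowerSeries ℝ} (hy0 : constantCoeff y = 0) {m j : ℕ}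
    (h : m < j) : coeff m (y ^ j) = 0 :=
  coeff_of_lt_order _ (lt_of_lt_of_le (by exact_mod_cast h) (le_order_pow_of_constantCoeff_eq_zero j hy0))

lemma coeff_subst_eq_sum {y : PowerSeries ℝ} (hy0 : constantCoeff y = 0) (F : PowerSeries ℝ)
    {m N : ℕ} (h : m < N) :
    coeff m (F.subst y) = ∑ j ∈ Finset.range N, coeff j F * coeff m (y ^ j) := by
  rw [coeff_subst' (HasSubst.of_constantCoeff_zero' hy0), finsum_eq_sum_of_support_subset]
  · rfl
  · intro j hj
    simp only [Finset.coe_range, Set.mem_Iio]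
    by_contra hlt
    exact hj (by simp [coeff_pow_eq_zero_of_lt hy0 (show m < j by omega)])

lemma coeff_X_mul_derivative (F : PowerSeries ℝ) (j : ℕ) :
    coeff j (X * derivative ℝ F) = j * coeff j F := by
  cases j with
  | zero => simp
  | succ j => rw [coeff_succ_X_mul, coeff_derivative]; push_cast; ring

/-- **Lagrange inversion** for the equation `y = x A(y)`. -/
theorem lagrange_inversion {A y : PowerSeries ℝ} (hy0 : constantCoeff y = 0)
    (hAy : y = (X : PowerSeries ℝ) * A.subst y) (n k : ℕ) (hkn : k ≤ n) :
    (n : ℝ) * coeff n (y ^ k) = k * coeff (n - k) (A ^ n) := by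
  induction n using Nat.strong_induction_on generalizing k with
  | _ n ih =>
  have hs : HasSubst y := HasSubst.of_constantCoeff_zero' hy0
  rcases Nat.eq_zero_or_pos k with rfl | hk
  · rcases Nat.eq_zero_or_pos n with rfl | hn
    · simp
    · simp [coeff_one, hn.ne']
  obtain ⟨m, rfl⟩ := Nat.exists_eq_add_of_le' hkn
  have hpow : y ^ k = X ^ k * (A ^ k).subst y := by
    rw [subst_pow hs, ← mul_pow, ← hAy]
  have hc : coeff (m + k) (y ^ k) =
      ∑ j ∈ Finset.range (m + 1), coeff j (A ^ k) * coeff m (y ^ j) := by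
    rw [hpow, coeff_X_pow_mul, coeff_subst_eq_sum hy0 _ (Nat.lt_succ_self m)]
  rw [Nat.add_sub_cancel]
  rcases Nat.eq_zero_or_pos m with rfl | hm
  · rw [hc]; simp
  -- The induction hypothesis at `m < m + k` turns `m [x^m] y^j` into `j [x^(m-j)] A^m`, and the sum
  -- becomes a Cauchy product.
  have h1 : (m : ℝ) * coeff (m + k) (y ^ k) = coeff m (X * derivative ℝ (A ^ k) * A ^ m) := by
    rw [hc, coeff_mul, Finset.Nat.sum_antidiagonal_eq_sum_range_succ_mk, Finset.mul_sum]
    refine Finset.sum_congr rfl fun j hj => ?_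
    have := ih m (by omega) j (by simpa [Nat.lt_succ_iff] using hj)
    rw [coeff_X_mul_derivative]
    linear_combination coeff j (A ^ k) * this
  have h2 : ((m + k : ℕ) : PowerSeries ℝ) * (X * derivative ℝ (A ^ k) * A ^ m)
      = (k : PowerSeries ℝ) * (X * derivative ℝ (A ^ (m + k))) := by
    rw [Derivation.leibniz_pow, Derivation.leibniz_pow]
    obtain ⟨l, rfl⟩ : ∃ l, k = l + 1 := ⟨k - 1, by omega⟩
    simp only [nsmul_eq_mul, smul_eq_mul, Nat.add_sub_cancel,
      show m + (l + 1) - 1 = m + l by omega, pow_add]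
    ring
  have h3 := congrArg (coeff m) h2
  rw [← map_natCast (C : ℝ →+* PowerSeries ℝ), ← map_natCast (C : ℝ →+* PowerSeries ℝ),
    coeff_C_mul, coeff_C_mul, coeff_X_mul_derivative, ← h1] at h3
  have hm' : (m : ℝ) ≠ 0 := by positivity
  exact mul_left_cancel₀ hm' (by linear_combination h3)

/-! ### Values in `[0, ∞]` of series with non-negative coefficients. -/

lemma coeff_mul_nonneg {f g : PowerSeries ℝ} (hf : ∀ n, 0 ≤ coeff n f) (hg : ∀ n, 0 ≤ coeff n g)
    (n : ℕ) : 0 ≤ coeff n (f * g) := by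
  rw [coeff_mul]
  exact Finset.sum_nonneg fun _ _ => mul_nonneg (hf _) (hg _)

lemma coeff_pow_nonneg {f : PowerSeries ℝ} (hf : ∀ n, 0 ≤ coeff n f) (k n : ℕ) :
    0 ≤ coeff n (f ^ k) := by
  induction k generalizing n with
  | zero => rw [pow_zero, coeff_one]; split_ifs <;> norm_num
  | succ k ih => rw [pow_succ]; exact coeff_mul_nonneg ih hf n

lemma value_mul {f g : PowerSeries ℝ} (hf : ∀ n, 0 ≤ coeff n f) (hg : ∀ n, 0 ≤ coeff n g)
    (t : ℝ≥0∞) : value (f * g) t = value f t * value g t := by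
  unfold value
  rw [← ENNReal.tsum_mul_right]
  simp_rw [← ENNReal.tsum_mul_left]
  rw [← ENNReal.tsum_prod (f := fun i j => ENNReal.ofReal (coeff i f) * t ^ i *
    (ENNReal.ofReal (coeff j g) * t ^ j)), ← (Finset.HasAntidiagonal.sigmaAntidiagonalEquivProd (A := ℕ)).tsum_eq,
    ENNReal.tsum_sigma']
  refine tsum_congr fun n => ?_
  rw [tsum_fintype, coeff_mul, ENNReal.ofReal_sum_of_nonneg fun _ _ => mul_nonneg (hf _) (hg _),
    Finset.sum_mul, ← Finset.sum_coe_sort]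
  refine Finset.sum_congr rfl fun p _ => ?_
  have hp : p.1.1 + p.1.2 = n := Finset.HasAntidiagonal.mem_antidiagonal.1 p.2
  simp only [Finset.HasAntidiagonal.sigmaAntidiagonalEquivProd_apply]
  rw [ENNReal.ofReal_mul (hf _), ← show t ^ p.1.1 * t ^ p.1.2 = t ^ n by rw [← pow_add, hp]]
  ring

lemma value_pow {f : PowerSeries ℝ} (hf : ∀ n, 0 ≤ coeff n f) (t : ℝ≥0∞) (k : ℕ) :
    value (f ^ k) t = value f t ^ k := by
  induction k with
  | zero =>
    rw [pow_zero, pow_zero, value, tsum_eq_single 0]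
    · simp
    · intro n hn; simp [coeff_one, hn]
  | succ k ih => rw [pow_succ, value_mul (coeff_pow_nonneg hf k) hf, ih, pow_succ]

/-- Tonelli: non-negative terms may be rearranged freely, so no convergence condition is needed. -/
lemma value_subst {F y : PowerSeries ℝ} (hy0 : constantCoeff y = 0) (hF : ∀ n, 0 ≤ coeff n F)
    (hy : ∀ n, 0 ≤ coeff n y) (t : ℝ≥0∞) : value (F.subst y) t = value F (value y t) := by
  have h : ∀ n, ENNReal.ofReal (coeff n (F.subst y)) * t ^ n
      = ∑' j, ENNReal.ofReal (coeff j F) * (ENNReal.ofReal (coeff n (y ^ j)) * t ^ n) := by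
    intro n
    rw [coeff_subst_eq_sum hy0 F (Nat.lt_succ_self n), ENNReal.ofReal_sum_of_nonneg
      fun _ _ => mul_nonneg (hF _) (coeff_pow_nonneg hy _ _), Finset.sum_mul,
      tsum_eq_sum (s := Finset.range (n + 1))]
    · refine Finset.sum_congr rfl fun j _ => ?_
      rw [ENNReal.ofReal_mul (hF _), mul_assoc]
    · intro j hj
      rw [coeff_pow_eq_zero_of_lt hy0 (by simpa using hj)]
      simp
  rw [value]
  simp_rw [h]
  rw [ENNReal.tsum_comm, value]
  refine tsum_congr fun j => ?_
  rw [ENNReal.tsum_mul_left, ← value_pow hy, value]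

/-! ### The solution as a least fixed point. -/

section FunctionalEquation

variable {A y : PowerSeries ℝ}

lemma coeff_solution_succ (hAy : y = (X : PowerSeries ℝ) * A.subst y) (n : ℕ) :
    coeff (n + 1) y = coeff n (A.subst y) := by
  conv_lhs => rw [hAy]
  rw [coeff_succ_X_mul]

lemma coeff_solution (hy0 : constantCoeff y = 0) (hAy : y = (X : PowerSeries ℝ) * A.subst y)
    (n : ℕ) : coeff (n + 1) y = coeff n (A ^ (n + 1)) / (n + 1) := by
  have := lagrange_inversion hy0 hAy (n + 1) 1 (by omega)
  rw [pow_one, Nat.add_sub_cancel] at this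
  push_cast at this
  field_simp
  linarith

lemma coeff_solution_nonneg (hy0 : constantCoeff y = 0)
    (hAy : y = (X : PowerSeries ℝ) * A.subst y) (hA : ∀ n, 0 ≤ coeff n A) (n : ℕ) :
    0 ≤ coeff n y := by
  cases n with
  | zero => simp [hy0]
  | succ n =>
    rw [coeff_solution hy0 hAy]
    have := coeff_pow_nonneg hA (n + 1) n
    positivity

lemma value_solution (hy0 : constantCoeff y = 0)
    (hAy : y = (X : PowerSeries ℝ) * A.subst y) (hA : ∀ n, 0 ≤ coeff n A) (t : ℝ≥0∞) :
    value y t = t * value A (value y t) := by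
  have hy := coeff_solution_nonneg hy0 hAy hA
  rw [← value_subst hy0 hA hy, value, tsum_eq_zero_add' ENNReal.summable, value,
    ← ENNReal.tsum_mul_left]
  simp only [coeff_solution_succ hAy, coeff_zero_eq_constantCoeff, hy0, ENNReal.ofReal_zero,
    zero_mul, zero_add]
  exact tsum_congr fun n => by ring

lemma value_mono {F : PowerSeries ℝ} : Monotone (value F) := fun _ _ h =>
  ENNReal.tsum_le_tsum fun n => by gcongr

/-- The value of the solution is the least solution of the functional inequality. -/
lemma value_solution_le (hy0 : constantCoeff y = 0)
    (hAy : y = (X : PowerSeries ℝ) * A.subst y) (hA : ∀ n, 0 ≤ coeff n A) {x z : ℝ≥0∞}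
    (h : x * value A z ≤ z) : value y x ≤ z := by
  have hy := coeff_solution_nonneg hy0 hAy hA
  suffices H : ∀ N, ∑ n ∈ Finset.range N, ENNReal.ofReal (coeff n y) * x ^ n ≤ z by
    rw [value, ENNReal.tsum_eq_iSup_nat]
    exact iSup_le H
  intro N
  induction N with
  | zero => simp
  | succ N ih =>
    -- Coefficients of `A(y)` below `N` depend only on the truncation `p` of `y`, so the next
    -- partial sum is at most `x A(p(x)) ≤ x A(z) ≤ z`.
    let p : PowerSeries ℝ := (trunc N y : Polynomial ℝ)
    have hpc : ∀ n, coeff n p = if n < N then coeff n y else 0 := fun n => by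
      simp [p, Polynomial.coeff_coe, coeff_trunc]
    have hp0 : constantCoeff p = 0 := by
      rw [← coeff_zero_eq_constantCoeff_apply, hpc]; simp [hy0]
    have hp : ∀ n, 0 ≤ coeff n p := fun n => by
      rw [hpc]; split_ifs; exacts [hy n, le_rfl]
    have hval : value p x = ∑ n ∈ Finset.range N, ENNReal.ofReal (coeff n y) * x ^ n := by
      rw [value, tsum_eq_sum (s := Finset.range N)]
      · exact Finset.sum_congr rfl fun n hn => by rw [hpc, if_pos (Finset.mem_range.1 hn)]
      · intro n hn
        rw [hpc, if_neg (by simpa using hn)]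
        simp
    have hpow : ∀ n < N, ∀ j, coeff n (y ^ j) = coeff n (p ^ j) := fun n hn j => by
      have := congrArg (fun q => Polynomial.coeff q n) (trunc_trunc_pow y N j)
      simp only [coeff_trunc, hn, if_true] at this
      exact this.symm
    have hsub : ∀ n < N, coeff n (A.subst y) = coeff n (A.subst p) := fun n hn => by
      rw [coeff_subst_eq_sum hy0 A (Nat.lt_succ_self n), coeff_subst_eq_sum hp0 A
        (Nat.lt_succ_self n)]
      exact Finset.sum_congr rfl fun j _ => by rw [hpow n hn]
    rw [Finset.sum_range_succ']
    calc _ = x * ∑ n ∈ Finset.range N, ENNReal.ofReal (coeff n (A.subst p)) * x ^ n := by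
          rw [Finset.mul_sum]
          simp only [coeff_zero_eq_constantCoeff, hy0, ENNReal.ofReal_zero, zero_mul, add_zero]
          refine Finset.sum_congr rfl fun n hn => ?_
          rw [coeff_solution_succ hAy, hsub n (Finset.mem_range.1 hn)]
          ring
      _ ≤ x * value (A.subst p) x := by
          gcongr
          exact ENNReal.sum_le_tsum _
      _ ≤ x * value A z := by
          rw [value_subst hp0 hA hp]
          gcongr
          exact value_mono (hval.trans_le ih)
      _ ≤ z := h

end FunctionalEquation

/-! ### Laplace's method. -/

section Laplace

open Real MeasureTheory

/-- Provides the Gaussian majorant for dominated convergence: near 0 the quadratic term beats the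
cubic error, and elsewhere compactness keeps `‖g‖` away from 1. -/
lemma exists_norm_le_exp_neg_mul_sq {g : ℝ → ℂ} (hg : Continuous g) {s C : ℝ} (hs : 0 < s)
    (hC : ∀ t, ‖g t - (1 - s * t ^ 2 / 2 : ℝ)‖ ≤ C * |t| ^ 3)
    (hlt : ∀ t, |t| ≤ π → t ≠ 0 → ‖g t‖ < 1) :
    ∃ c > 0, ∀ t, |t| ≤ π → ‖g t‖ ≤ exp (-(c * t ^ 2)) := by
  -- The three bounds make the cubic error at most `s t² / 4`, make `1 - s t² / 2` non-negative, and
  -- put `π` in the compact set below.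
  set δ : ℝ := min (min (s / (4 * (|C| + 1))) (1 / (s + 1))) π with hδ
  have hC0 := abs_nonneg C
  have hδ0 : 0 < δ := by have := pi_pos; positivity
  have hδ1 : δ * (4 * (|C| + 1)) ≤ s := by
    rw [← le_div_iff₀ (by positivity)]; exact (min_le_left _ _).trans (min_le_left _ _)
  have hδ2 : δ * (s + 1) ≤ 1 := by
    rw [← le_div_iff₀ (by positivity)]; exact (min_le_left _ _).trans (min_le_right _ _)
  have hK : IsCompact (Set.Icc (-π) π ∩ {t : ℝ | δ ≤ |t|}) :=
    isCompact_Icc.inter_right (isClosed_le continuous_const continuous_abs)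
  obtain ⟨t₀, ⟨ht₀, ht₀'⟩, hmax⟩ := hK.exists_isMaxOn
    ⟨π, ⟨by linarith [pi_pos], le_rfl⟩, by
      simp only [Set.mem_ofPred_eq, abs_of_pos pi_pos]; exact min_le_right _ _⟩
    hg.norm.continuousOn
  have hM : ‖g t₀‖ < 1 := hlt t₀ (abs_le.2 ht₀) (abs_pos.1 (hδ0.trans_le ht₀'))
  refine ⟨min (s / 4) ((1 - ‖g t₀‖) / π ^ 2), lt_min (by positivity)
    (div_pos (by linarith) (by positivity)), fun t ht => ?_⟩
  have hexp := add_one_le_exp (-(min (s / 4) ((1 - ‖g t₀‖) / π ^ 2) * t ^ 2))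
  refine le_trans ?_ hexp
  rcases le_total |t| δ with h | h
  · have h0 := abs_nonneg t
    have h1 : s * t ^ 2 ≤ 2 := by
      have h2 : |t| * (s + 1) ≤ 1 := le_trans (by gcongr) hδ2
      have h3 : |t| * s ≤ 1 := by nlinarith
      rw [← sq_abs]
      nlinarith
    have h2 : ‖((1 - s * t ^ 2 / 2 : ℝ) : ℂ)‖ = 1 - s * t ^ 2 / 2 := by
      rw [Complex.norm_real, norm_eq_abs, abs_of_nonneg (by linarith)]
    have h3 := norm_le_norm_add_norm_sub' (g t) ((1 - s * t ^ 2 / 2 : ℝ) : ℂ)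
    have h4 : C * |t| ^ 3 ≤ s / 4 * t ^ 2 := by
      rw [← sq_abs t, pow_succ' |t|, ← mul_assoc]
      gcongr
      nlinarith [le_abs_self C]
    have h5 : min (s / 4) ((1 - ‖g t₀‖) / π ^ 2) * t ^ 2 ≤ s / 4 * t ^ 2 := by
      gcongr; exact min_le_left _ _
    linarith [hC t]
  · have h1 : ‖g t‖ ≤ ‖g t₀‖ := hmax ⟨abs_le.1 ht, h⟩
    have h2 : min (s / 4) ((1 - ‖g t₀‖) / π ^ 2) * t ^ 2 ≤ (1 - ‖g t₀‖) / π ^ 2 * π ^ 2 := by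
      have : t ^ 2 ≤ π ^ 2 := by rw [← sq_abs]; gcongr
      have h6 : 0 ≤ (1 - ‖g t₀‖) / π ^ 2 := div_nonneg (by linarith) (by positivity)
      gcongr; exact min_le_right _ _
    rw [div_mul_cancel₀ _ (by positivity)] at h2
    linarith

/-- **Laplace's method** for the integral of `g ^ n * h` over `[-π, π]`, where `|g|` has its only
maximum at the origin and it is non-degenerate. -/
theorem tendsto_sqrt_mul_integral_pow {g h : ℝ → ℂ} (hg : Continuous g) (hh : Continuous h)
    (hh0 : h 0 = 1) (hh1 : ∀ t, ‖h t‖ ≤ 1) {s C : ℝ} (hs : 0 < s)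
    (hC : ∀ t, ‖g t - (1 - s * t ^ 2 / 2 : ℝ)‖ ≤ C * |t| ^ 3)
    (hlt : ∀ t, |t| ≤ π → t ≠ 0 → ‖g t‖ < 1) :
    Tendsto (fun n : ℕ => (√n : ℂ) * ∫ t in (-π)..π, g t ^ n * h t) atTop
      (𝓝 (√(2 * π / s) : ℝ)) := by
  obtain ⟨c, hc, hgc⟩ := exists_norm_le_exp_neg_mul_sq hg hs hC hlt
  -- Substitute `t = u / √n` and extend by zero, so that all integrals are over the whole line.
  let F : ℕ → ℝ → ℂ := fun n u => (Set.Ioc (-π * √n) (π * √n)).indicator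
    (fun u => g (u / √n) ^ n * h (u / √n)) u
  have hint : ∀ n : ℕ, 0 < n →
      (√n : ℂ) * ∫ t in (-π)..π, g t ^ n * h t = ∫ u, F n u := by
    intro n hn
    have hn' : √(n : ℝ) ≠ 0 := by positivity
    have := intervalIntegral.integral_comp_div (a := -π * √n) (b := π * √n)
      (fun t => g t ^ n * h t) hn'
    rw [mul_div_cancel_right₀ _ hn', mul_div_cancel_right₀ _ hn', Complex.real_smul] at this
    rw [← this, intervalIntegral.integral_of_le (by gcongr; linarith [pi_pos]),
      integral_indicator measurableSet_Ioc]
  have hlim : (√(2 * π / s) : ℝ) = ∫ u : ℝ, Complex.exp ((-(s / 2) * u ^ 2 : ℝ) : ℂ) := by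
    simp_rw [← Complex.ofReal_exp]
    rw [integral_complex_ofReal, integral_gaussian]
    congr 2
    field_simp
  rw [hlim]
  refine Tendsto.congr' (f₁ := fun n => ∫ u, F n u) ?_ ?_
  · filter_upwards [eventually_gt_atTop 0] with n hn using (hint n hn).symm
  refine tendsto_integral_of_dominated_convergence (fun u => exp (-c * u ^ 2)) ?_
    (integrable_exp_neg_mul_sq hc) ?_ ?_
  · intro n
    refine AEStronglyMeasurable.indicator ?_ measurableSet_Ioc
    exact (by fun_prop : Continuous fun u : ℝ => g (u / √n) ^ n * h (u / √n)).aestronglyMeasurable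
  · intro n
    refine ae_of_all _ fun u => ?_
    by_cases hu : u ∈ Set.Ioc (-π * √n) (π * √n)
    · have hn : 0 < √(n : ℝ) := by
        by_contra hn
        have : √(n : ℝ) = 0 := le_antisymm (not_lt.1 hn) (sqrt_nonneg _)
        rw [this] at hu
        simp at hu
      have ht : |u / √n| ≤ π := by
        rw [abs_le, le_div_iff₀ hn, div_le_iff₀ hn]
        exact ⟨hu.1.le, hu.2⟩
      simp only [F, Set.indicator_of_mem hu, norm_mul, norm_pow]
      calc ‖g (u / √n)‖ ^ n * ‖h (u / √n)‖ ≤ exp (-(c * (u / √n) ^ 2)) ^ n * 1 := by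
            gcongr
            exacts [hgc _ ht, hh1 _]
        _ = exp (-c * u ^ 2) := by
            rw [mul_one, ← exp_nat_mul, div_pow, sq_sqrt (Nat.cast_nonneg n)]
            have : (n : ℝ) ≠ 0 := (sqrt_pos.1 hn).ne'
            congr 1
            field_simp
    · simp only [F, Set.indicator_of_notMem hu, norm_zero]
      positivity
  · refine ae_of_all _ fun u => ?_
    have hsq : Tendsto (fun n : ℕ => √(n : ℝ)) atTop atTop :=
      tendsto_sqrt_atTop.comp tendsto_natCast_atTop_atTop
    have ht : Tendsto (fun n : ℕ => u / √(n : ℝ)) atTop (𝓝 0) := hsq.const_div_atTop u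
    have h1 : Tendsto (fun n : ℕ => h (u / √n)) atTop (𝓝 1) := by
      rw [← hh0]; exact (hh.tendsto 0).comp ht
    have h2 : Tendsto (fun n : ℕ => (n : ℂ) * (g (u / √n) - 1)) atTop
        (𝓝 ((-(s / 2) * u ^ 2 : ℝ) : ℂ)) := by
      rw [tendsto_iff_norm_sub_tendsto_zero]
      refine squeeze_zero' (Eventually.of_forall fun _ => norm_nonneg _) ?_
        (hsq.const_div_atTop (C * |u| ^ 3))
      filter_upwards [eventually_gt_atTop 0] with n hn
      have hn' : (0 : ℝ) < n := by exact_mod_cast hn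
      have hq : √(n : ℝ) ^ 2 = n := sq_sqrt hn'.le
      have hq0 : 0 < √(n : ℝ) := by positivity
      have e : (n : ℂ) * (g (u / √n) - 1) - ((-(s / 2) * u ^ 2 : ℝ) : ℂ)
          = (n : ℂ) * (g (u / √n) - (1 - s * (u / √n) ^ 2 / 2 : ℝ)) := by
        have : ((-(s / 2) * u ^ 2 : ℝ) : ℂ) = (n : ℂ) * ((-(s / 2) * (u / √n) ^ 2 : ℝ) : ℂ) := by
          rw [div_pow, hq]
          push_cast
          have : (n : ℂ) ≠ 0 := by exact_mod_cast hn.ne'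
          field_simp
        rw [this]
        push_cast
        ring
      rw [e, norm_mul, Complex.norm_natCast]
      calc (n : ℝ) * _ ≤ n * (C * |u / √n| ^ 3) := by gcongr; exact hC _
        _ = C * |u| ^ 3 / √n := by
          rw [abs_div, abs_of_pos hq0, div_pow]
          nth_rewrite 1 [← hq]
          field_simp
    have h3 := (Complex.tendsto_one_add_pow_exp_of_tendsto h2).mul h1
    simp only [add_sub_cancel, mul_one] at h3
    refine h3.congr' ?_
    filter_upwards [hsq.eventually_gt_atTop |u|] with n hn
    have hπ : 1 < π := by linarith [pi_gt_three]
    have : |u| < π * √n := by nlinarith [abs_nonneg u]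
    rw [abs_lt] at this
    have hmem : u ∈ Set.Ioc (-π * √n) (π * √n) := ⟨by linarith, by linarith⟩
    simp only [F, Set.indicator_of_mem hmem]

end Laplace

/-! ### Taylor bound for `exp (ix)` and Fourier coefficients. -/

section Fourier

open Real

lemma norm_exp_mul_I_sub_le (x : ℝ) :
    ‖Complex.exp (x * Complex.I) - (1 + x * Complex.I - x ^ 2 / 2)‖ ≤ 4 * |x| ^ 3 := by
  have hn : ‖(x : ℂ) * Complex.I‖ = |x| := by simp
  rcases le_total |x| 1 with h | h
  · have := Complex.exp_bound (x := x * Complex.I) (by rwa [hn]) (n := 3) (by norm_num)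
    rw [hn] at this
    simp only [Finset.sum_range_succ, Finset.sum_range_zero, Nat.factorial] at this
    have e : Complex.exp (x * Complex.I) - (1 + x * Complex.I - x ^ 2 / 2) =
      Complex.exp (x * Complex.I) - (0 + (x * Complex.I) ^ 0 / ((1 : ℕ) : ℂ) +
        (x * Complex.I) ^ 1 / (((0 + 1) * 1 : ℕ) : ℂ) +
        (x * Complex.I) ^ 2 / (((1 + 1) * ((0 + 1) * 1) : ℕ) : ℂ)) := by
      rw [mul_pow _ _ 2, Complex.I_sq]; push_cast; ring
    rw [e]
    refine this.trans ?_
    norm_num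
    nlinarith [pow_nonneg (abs_nonneg x) 3]
  · calc _ ≤ ‖Complex.exp (x * Complex.I)‖ + (‖(1 : ℂ)‖ + ‖x * Complex.I‖ + ‖(x : ℂ) ^ 2 / 2‖) :=
          (norm_sub_le _ _).trans (by gcongr; exact (norm_sub_le _ _).trans (by
            gcongr; exact norm_add_le _ _))
      _ = 1 + (1 + |x| + |x| ^ 2 / 2) := by
          rw [Complex.norm_exp_ofReal_mul_I, hn]; simp
      _ ≤ 4 * |x| ^ 3 := by
          nlinarith [mul_nonneg (abs_nonneg x) (sub_nonneg.2 h), mul_nonneg (sq_nonneg |x|) (sub_nonneg.2 h)]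

lemma integral_exp_int_mul_I (m : ℤ) (hm : m ≠ 0) :
    ∫ t in (-π)..π, Complex.exp (m * Complex.I * t) = 0 := by
  have hm' : (m : ℂ) * Complex.I ≠ 0 := mul_ne_zero (by exact_mod_cast hm) Complex.I_ne_zero
  rw [integral_exp_mul_complex hm', div_eq_zero_iff]
  left
  rw [sub_eq_zero, Complex.exp_eq_exp_iff_exists_int]
  exact ⟨m, by push_cast; ring⟩

/-- Absolute convergence permits termwise integration, and orthogonality leaves only the term `m`.
-/
lemma integral_tsum_mul_exp {c : ℕ → ℂ} (hc : Summable fun k => ‖c k‖) (m : ℕ) :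
    ∫ t in (-π)..π, (∑' k, c k * Complex.exp (k * Complex.I * t)) *
      Complex.exp (-(m * Complex.I * t)) = 2 * π * c m := by
  let f : ℕ → C(ℝ, ℂ) := fun k =>
    ⟨fun t => c k * Complex.exp (((k - m : ℤ) : ℂ) * Complex.I * t), by fun_prop⟩
  have hnorm : ∀ k (t : ℝ), ‖f k t‖ = ‖c k‖ := fun k t => by
    have : ((k - m : ℤ) : ℂ) * Complex.I * t = ((k - m : ℤ) * t : ℝ) * Complex.I := by
      push_cast; ring
    simp only [f, ContinuousMap.coe_mk]
    rw [this, norm_mul, Complex.norm_exp_ofReal_mul_I, mul_one]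
  have hsum := intervalIntegral.hasSum_intervalIntegral_of_summable_norm (a := -π) (b := π) (f := f)
    (hc.of_nonneg_of_le (fun _ => norm_nonneg _) fun k =>
      (ContinuousMap.norm_le _ (norm_nonneg _)).2 fun t => (hnorm k t).le)
  have hint : ∀ t : ℝ, (∑' k, c k * Complex.exp (k * Complex.I * t)) *
      Complex.exp (-(m * Complex.I * t)) = ∑' k, f k t := fun t => by
    rw [← tsum_mul_right]
    refine tsum_congr fun k => ?_
    simp only [f, ContinuousMap.coe_mk]
    rw [mul_assoc, ← Complex.exp_add]
    congr 2
    push_cast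
    ring
  simp_rw [hint]
  rw [← hsum.tsum_eq, tsum_eq_single m]
  · simp [f, two_mul]
  · intro k hk
    simp only [f, ContinuousMap.coe_mk]
    rw [intervalIntegral.integral_const_mul, integral_exp_int_mul_I _ (by omega), mul_zero]

end Fourier

/-! ### Characteristic functions of laws on `ℕ`. -/

section CentredCharFn

open Real

/-- The characteristic function of `ξ - 1`, where `ξ` has the distribution `p` on `ℕ`. -/
def centredCharFn (p : ℕ → ℝ) (t : ℝ) : ℂ :=
  ∑' k : ℕ, (p k : ℂ) * Complex.exp (((k - 1 : ℝ) * t : ℝ) * Complex.I)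

variable {p : ℕ → ℝ}

lemma norm_centredCharFn_term (hp : ∀ k, 0 ≤ p k) (k : ℕ) (t : ℝ) :
    ‖(p k : ℂ) * Complex.exp (((k - 1 : ℝ) * t : ℝ) * Complex.I)‖ = p k := by
  rw [norm_mul, Complex.norm_exp_ofReal_mul_I, mul_one, Complex.norm_real, norm_of_nonneg (hp k)]

lemma summable_centredCharFn (hp : ∀ k, 0 ≤ p k) (h1 : Summable p) (t : ℝ) :
    Summable fun k : ℕ => (p k : ℂ) * Complex.exp (((k - 1 : ℝ) * t : ℝ) * Complex.I) :=
  .of_norm (by simpa only [norm_centredCharFn_term hp] using h1)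

lemma continuous_centredCharFn (hp : ∀ k, 0 ≤ p k) (h1 : Summable p) :
    Continuous (centredCharFn p) :=
  continuous_tsum (fun k => by fun_prop) h1 fun k t => (norm_centredCharFn_term hp k t).le

/-- Taylor expansion term by term; the zero mean removes the linear part, and the third absolute
moment bounds the remainder. -/
lemma norm_centredCharFn_sub_le (hp : ∀ k, 0 ≤ p k) (h1 : HasSum p 1) {s : ℝ}
    (hm : HasSum (fun k : ℕ => p k * ((k : ℝ) - 1)) 0)
    (hv : HasSum (fun k : ℕ => p k * ((k : ℝ) - 1) ^ 2) s)
    (h3 : Summable fun k : ℕ => p k * |(k : ℝ) - 1| ^ 3) (t : ℝ) :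
    ‖centredCharFn p t - (1 - s * t ^ 2 / 2 : ℝ)‖ ≤
      4 * (∑' k : ℕ, p k * |(k : ℝ) - 1| ^ 3) * |t| ^ 3 := by
  have hexp : HasSum (fun k : ℕ => (p k : ℂ) * (1 + (((k - 1 : ℝ) * t : ℝ) : ℂ) * Complex.I
      - (((k - 1 : ℝ) * t : ℝ) : ℂ) ^ 2 / 2)) ((1 - s * t ^ 2 / 2 : ℝ) : ℂ) := by
    have e := ((Complex.hasSum_ofReal.2 h1).add
      ((Complex.hasSum_ofReal.2 hm).mul_left (t * Complex.I))).sub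
      ((Complex.hasSum_ofReal.2 hv).mul_left ((t : ℂ) ^ 2 / 2))
    convert! e using 1
    · ext k; push_cast; ring
    · push_cast; ring
  have hd := ((summable_centredCharFn hp h1.summable t).hasSum.sub hexp)
  rw [centredCharFn, ← hd.tsum_eq, mul_assoc, mul_comm _ (|t| ^ 3), ← mul_assoc, ← tsum_mul_left]
  refine tsum_of_norm_bounded (h3.mul_left _).hasSum fun k => ?_
  rw [← mul_sub, norm_mul, Complex.norm_real, norm_of_nonneg (hp k)]
  have := norm_exp_mul_I_sub_le ((k - 1 : ℝ) * t)
  rw [abs_mul, mul_pow] at this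
  calc _ ≤ p k * _ := mul_le_mul_of_nonneg_left this (hp k)
    _ = _ := by ring

/-- Otherwise `exp (ixt) = 1` on the ideal generated by `S`, which contains 1, and `t` would be a
non-zero multiple of `2π`. -/
lemma exists_exp_ne_one {S : Set ℕ} (hS : Nat.setGcd S = 1) {t : ℝ} (ht : |t| ≤ π) (ht0 : t ≠ 0) :
    ∃ k ∈ S, Complex.exp (k * (t * Complex.I)) ≠ 1 := by
  by_contra! H
  have h1 : (1 : ℤ) ∈ Ideal.span (((↑) : ℕ → ℤ) '' S) := by
    rw [← Nat.span_singleton_setGcd, hS]; simp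
  have key : ∀ x ∈ Ideal.span (((↑) : ℕ → ℤ) '' S),
      Complex.exp ((x : ℂ) * (t * Complex.I)) = 1 := by
    intro x hx
    induction hx using Submodule.span_induction with
    | mem x hx =>
      obtain ⟨k, hk, rfl⟩ := hx
      simpa using H k hk
    | zero => simp
    | add x y _ _ hx hy => rw [Int.cast_add, add_mul, Complex.exp_add, hx, hy, mul_one]
    | smul a x _ hx =>
      rw [smul_eq_mul, Int.cast_mul, mul_assoc, Complex.exp_int_mul, hx, one_zpow]
  have h2 := key 1 h1
  rw [Int.cast_one, one_mul, Complex.exp_eq_one_iff] at h2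
  obtain ⟨n, hn⟩ := h2
  have h3 : t = n * (2 * π) := by
    have : (t : ℂ) = n * (2 * π) := mul_right_cancel₀ Complex.I_ne_zero (by rw [hn]; ring)
    exact_mod_cast this
  have hn0 : n ≠ 0 := by rintro rfl; simp at h3; exact ht0 h3
  have h4 : (1 : ℝ) ≤ |(n : ℝ)| := by exact_mod_cast Int.one_le_abs hn0
  rw [h3, abs_mul, abs_of_pos two_pi_pos] at ht
  nlinarith [pi_pos]

lemma norm_add_mul_lt {a b : ℝ} (ha : 0 < a) (hb : 0 < b) {w : ℂ} (hw : ‖w‖ = 1) (hw1 : w ≠ 1) :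
    ‖(a : ℂ) + b * w‖ < a + b := by
  have h1 : w.re * w.re + w.im * w.im = 1 := by
    rw [← Complex.normSq_apply, Complex.normSq_eq_norm_sq, hw, one_pow]
  have h2 : w.re < 1 := by
    by_contra h
    have him : w.im = 0 := by nlinarith [mul_self_nonneg w.im]
    have hre : w.re = 1 := by
      rw [him] at h1
      nlinarith
    exact hw1 (Complex.ext hre him)
  refine lt_of_pow_lt_pow_left₀ 2 (by positivity) ?_
  rw [← Complex.normSq_eq_norm_sq, Complex.normSq_apply]
  simp only [Complex.add_re, Complex.mul_re, Complex.ofReal_re, Complex.ofReal_im, Complex.add_im,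
    Complex.mul_im]
  have e : (a + b) ^ 2 - ((a + (b * w.re - 0 * w.im)) * (a + (b * w.re - 0 * w.im)) +
      (0 + (b * w.im + 0 * w.re)) * (0 + (b * w.im + 0 * w.re))) = 2 * (a * b * (1 - w.re)) := by
    linear_combination (-b ^ 2) * h1
  linarith [mul_pos (mul_pos ha hb) (sub_pos.2 h2)]

/-- The atoms at 0 and at some `k` are out of phase, which already makes the triangle inequality
strict. -/
lemma norm_centredCharFn_lt_one (hp : ∀ k, 0 ≤ p k) (h1 : HasSum p 1) (hp0 : 0 < p 0)
    (hgcd : Nat.setGcd {n : ℕ | 1 ≤ n ∧ 0 < p n} = 1) {t : ℝ} (ht : |t| ≤ π) (ht0 : t ≠ 0) :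
    ‖centredCharFn p t‖ < 1 := by
  obtain ⟨k, ⟨hk1, hk⟩, hne⟩ := exists_exp_ne_one hgcd ht ht0
  have hsum := summable_centredCharFn hp h1.summable t
  have hk0 : (0 : ℕ) ≠ k := by omega
  have hp1 := h1.summable.sum_add_tsum_compl (s := {0, k})
  rw [h1.tsum_eq, Finset.sum_pair hk0] at hp1
  rw [centredCharFn, ← hsum.sum_add_tsum_compl (s := {0, k}), Finset.sum_pair hk0]
  refine ((norm_add_le _ _).trans_lt (add_lt_add_of_lt_of_le ?_ ?_)).trans_eq hp1
  · have e : (p 0 : ℂ) * Complex.exp ((((0 : ℕ) - 1 : ℝ) * t : ℝ) * Complex.I)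
        + (p k : ℂ) * Complex.exp (((k - 1 : ℝ) * t : ℝ) * Complex.I)
        = ((p 0 : ℂ) + p k * Complex.exp (k * (t * Complex.I))) *
          Complex.exp ((-t : ℝ) * Complex.I) := by
      rw [add_mul, mul_assoc (p k : ℂ), ← Complex.exp_add]
      congr 3 <;> push_cast <;> ring_nf
    rw [e, norm_mul, Complex.norm_exp_ofReal_mul_I, mul_one]
    refine norm_add_mul_lt hp0 hk ?_ hne
    rw [← mul_assoc, ← Complex.ofReal_natCast, ← Complex.ofReal_mul,
      Complex.norm_exp_ofReal_mul_I]
  · refine tsum_of_norm_bounded (h1.summable.subtype _).hasSum fun j => ?_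
    exact (norm_centredCharFn_term hp _ t).le

end CentredCharFn

/-! ### Coefficients of large powers. -/

section Powers

lemma tsum_coeff_pow {F : PowerSeries ℝ} {z : ℂ} (h : Summable fun k => ‖((coeff k F : ℝ) : ℂ) * z ^ k‖)
    (n : ℕ) : (Summable fun k => ‖((coeff k (F ^ n) : ℝ) : ℂ) * z ^ k‖) ∧
      ∑' k, ((coeff k (F ^ n) : ℝ) : ℂ) * z ^ k = (∑' k, ((coeff k F : ℝ) : ℂ) * z ^ k) ^ n := by
  induction n with
  | zero =>
    have h0 : ∀ k ≠ 0, ((coeff k (F ^ 0) : ℝ) : ℂ) * z ^ k = 0 := fun k hk => by simp [coeff_one, hk]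
    refine ⟨summable_of_ne_finset_zero (s := {0}) fun k hk => ?_, ?_⟩
    · rw [h0 k (by simpa using hk), norm_zero]
    · rw [tsum_eq_single 0 h0]; simp
  | succ n ih =>
    have e : ∀ k, ((coeff k (F ^ (n + 1)) : ℝ) : ℂ) * z ^ k =
        ∑ ij ∈ Finset.HasAntidiagonal.antidiagonal k, (((coeff ij.1 (F ^ n) : ℝ) : ℂ) * z ^ ij.1) *
          (((coeff ij.2 F : ℝ) : ℂ) * z ^ ij.2) := fun k => by
      rw [pow_succ, coeff_mul, Complex.ofReal_sum, Finset.sum_mul]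
      refine Finset.sum_congr rfl fun ij hij => ?_
      rw [← Finset.HasAntidiagonal.mem_antidiagonal.1 hij, pow_add]
      push_cast
      ring
    have hs := summable_norm_sum_mul_antidiagonal_of_summable_norm ih.1 h
    have ht := tsum_mul_tsum_eq_tsum_sum_antidiagonal_of_summable_norm ih.1 h
    refine ⟨hs.congr fun k => congrArg norm (e k).symm, ?_⟩
    rw [tsum_congr e, ← ht, ih.2, pow_succ]

lemma abs_sub_one_pow_le (k : ℕ) {j : ℕ} (hj : j ≤ 3) : |(k : ℝ) - 1| ^ j ≤ (k : ℝ) ^ 3 + 1 := by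
  rcases Nat.eq_zero_or_pos k with rfl | hk
  · simp
  · have hk' : (1 : ℝ) ≤ k := by exact_mod_cast hk
    rw [abs_of_nonneg (by linarith)]
    calc ((k : ℝ) - 1) ^ j ≤ (k : ℝ) ^ j := pow_le_pow_left₀ (by linarith) (by linarith) _
      _ ≤ (k : ℝ) ^ 3 := pow_le_pow_right₀ hk' hj
      _ ≤ _ := by linarith

open Real in
/-- A local limit theorem for the coefficients of large powers. -/
theorem tendsto_sqrt_mul_coeff_pow {A : PowerSeries ℝ} (hA : ∀ n, 0 ≤ coeff n A)
    (hA0 : 0 < coeff 0 A) (hgcd : Nat.setGcd {n : ℕ | 1 ≤ n ∧ 0 < coeff n A} = 1) {τ : ℝ}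
    (hτ : 0 < τ) (hs0 : Summable fun k => coeff k A * τ ^ k)
    (hs3 : Summable fun k => coeff k A * τ ^ k * (k : ℝ) ^ 3)
    (hmean : ∑' k, coeff k A * τ ^ k * ((k : ℝ) - 1) = 0) :
    ∃ L : ℝ, 0 < L ∧ Tendsto (fun n : ℕ => √n * (coeff (n - 1) (A ^ n) * τ ^ (n - 1) / fn A τ ^ n))
      atTop (𝓝 L) := by
  have hb : ∀ k, 0 ≤ coeff k A * τ ^ k := fun k => mul_nonneg (hA k) (by positivity)
  have hM : 0 < fn A τ := by
    rw [fn]; exact hs0.tsum_pos hb 0 (by simpa using hA0)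
  -- The law of `A` tilted at `τ`; `hmean` says that its mean is 1.
  set p : ℕ → ℝ := fun k => coeff k A * τ ^ k / fn A τ with hpdef
  have hp : ∀ k, 0 ≤ p k := fun k => div_nonneg (hb k) hM.le
  have h1 : HasSum p 1 := by
    have := hs0.hasSum.div_const (fn A τ)
    rwa [show ∑' k, coeff k A * τ ^ k = fn A τ from rfl, div_self hM.ne'] at this
  have hdom : ∀ j ≤ 3, Summable fun k : ℕ => p k * |(k : ℝ) - 1| ^ j := fun j hj => by
    refine .of_nonneg_of_le (fun k => mul_nonneg (hp k) (by positivity)) (fun k => ?_)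
      ((hs3.add hs0).div_const (fn A τ))
    calc _ ≤ p k * ((k : ℝ) ^ 3 + 1) := by
          gcongr
          exacts [hp k, abs_sub_one_pow_le k hj]
      _ = _ := by simp only [hpdef]; ring
  have hm : HasSum (fun k : ℕ => p k * ((k : ℝ) - 1)) 0 := by
    have hsm : Summable fun k : ℕ => p k * ((k : ℝ) - 1) := by
      refine .of_norm ((hdom 1 (by norm_num)).congr fun k => ?_)
      rw [norm_mul, norm_of_nonneg (hp k), pow_one, norm_eq_abs]
    have : ∑' k : ℕ, p k * ((k : ℝ) - 1) = 0 := by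
      rw [← zero_div (fn A τ), ← hmean, ← tsum_div_const]
      exact tsum_congr fun k => by simp only [hpdef]; ring
    exact this ▸ hsm.hasSum
  have hvs : Summable fun k : ℕ => p k * ((k : ℝ) - 1) ^ 2 := by
    simpa only [sq_abs] using hdom 2 (by norm_num)
  have hp0 : 0 < p 0 := by simpa [hpdef] using div_pos hA0 hM
  set s := ∑' k : ℕ, p k * ((k : ℝ) - 1) ^ 2 with hs
  have hspos : 0 < s := hvs.tsum_pos (fun k => mul_nonneg (hp k) (sq_nonneg _)) 0 (by simpa using hp0)
  have hgcd' : Nat.setGcd {n : ℕ | 1 ≤ n ∧ 0 < p n} = 1 := by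
    refine Eq.trans (congrArg Nat.setGcd ?_) hgcd
    ext n
    simp only [hpdef, Set.mem_ofPred_eq]
    rw [div_pos_iff_of_pos_right hM, mul_pos_iff_of_pos_right (by positivity)]
  -- Centring shifts the sum by `n` whereas the coefficient wanted is at `n - 1`; the factor `exp
  -- (it)` makes up the difference.
  have key := tendsto_sqrt_mul_integral_pow (g := centredCharFn p)
    (h := fun t => Complex.exp (t * Complex.I)) (continuous_centredCharFn hp h1.summable)
    (by fun_prop) (by simp) (fun t => (Complex.norm_exp_ofReal_mul_I t).le) hspos
    (norm_centredCharFn_sub_le hp h1 hm hvs.hasSum (hdom 3 le_rfl))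
    (fun t => norm_centredCharFn_lt_one hp h1 hp0 hgcd')
  have hz : ∀ t : ℝ, Summable fun k => ‖((coeff k A : ℝ) : ℂ) * (τ * Complex.exp (Complex.I * t)) ^ k‖ :=
    fun t => hs0.congr fun k => by
      rw [norm_mul, norm_pow, norm_mul, mul_comm Complex.I, Complex.norm_exp_ofReal_mul_I, mul_one,
        Complex.norm_real, Complex.norm_real, norm_of_nonneg (hA k), norm_of_nonneg hτ.le]
  have hterm : ∀ (F : PowerSeries ℝ) (t : ℝ) (k : ℕ),
      ((coeff k F : ℝ) : ℂ) * (τ * Complex.exp (Complex.I * t)) ^ k =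
        ((coeff k F * τ ^ k : ℝ) : ℂ) * Complex.exp (k * Complex.I * t) := fun F t k => by
    rw [mul_pow, ← Complex.exp_nat_mul]
    push_cast
    rw [mul_assoc, mul_assoc (k : ℂ)]
  have hint : ∀ n : ℕ, 0 < n → ∫ t in (-π)..π, centredCharFn p t ^ n * Complex.exp (t * Complex.I)
      = ((2 * π * (coeff (n - 1) (A ^ n) * τ ^ (n - 1) / fn A τ ^ n) : ℝ) : ℂ) := by
    intro n hn
    have hc : Summable fun k => ‖((coeff k (A ^ n) * τ ^ k : ℝ) : ℂ)‖ := by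
      refine (tsum_coeff_pow (hz 0) n).1.congr fun k => ?_
      rw [hterm]; simp
    have hF := integral_tsum_mul_exp hc (n - 1)
    have e : ∀ t : ℝ, centredCharFn p t ^ n * Complex.exp (t * Complex.I) =
        (fn A τ : ℂ)⁻¹ ^ n * ((∑' k, ((coeff k (A ^ n) * τ ^ k : ℝ) : ℂ) *
          Complex.exp (k * Complex.I * t)) * Complex.exp (-((n - 1 : ℕ) * Complex.I * t))) := by
      intro t
      have e1 : centredCharFn p t = (fn A τ : ℂ)⁻¹ * (∑' k, ((coeff k A : ℝ) : ℂ) *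
          (τ * Complex.exp (Complex.I * t)) ^ k) * Complex.exp (-(t * Complex.I)) := by
        rw [centredCharFn, ← tsum_mul_left, ← tsum_mul_right]
        refine tsum_congr fun k => ?_
        rw [hterm, mul_assoc, mul_assoc, ← Complex.exp_add, ← mul_assoc]
        congr 2
        · simp only [hpdef]; push_cast; ring
        · push_cast; ring
      have e2 := (tsum_coeff_pow (hz t) n).2
      simp_rw [hterm (A ^ n)] at e2
      rw [e2, e1, mul_pow, mul_pow, mul_assoc, mul_assoc, ← Complex.exp_nat_mul, ← Complex.exp_add]
      congr 4
      rw [Nat.cast_sub hn]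
      push_cast
      ring
    simp_rw [e]
    rw [intervalIntegral.integral_const_mul, hF]
    push_cast
    rw [inv_pow]
    ring
  refine ⟨√(2 * π / s) / (2 * π), by positivity, ?_⟩
  have h2 : Tendsto (fun n : ℕ => ((√n * (2 * π * (coeff (n - 1) (A ^ n) * τ ^ (n - 1) /
      fn A τ ^ n)) : ℝ) : ℂ)) atTop (𝓝 (√(2 * π / s) : ℝ)) := by
    refine key.congr' ?_
    filter_upwards [eventually_gt_atTop 0] with n hn
    rw [hint n hn, Complex.ofReal_mul √(n : ℝ)]
  have h3 := ((Complex.continuous_re.tendsto _).comp h2).div_const (2 * π)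
  simp only [Complex.ofReal_re] at h3
  refine h3.congr fun n => ?_
  simp only [Function.comp, Complex.ofReal_re]
  field_simp

end Powers

/-! ### Convergence and differentiation inside the radius. -/

section Radius

variable {F : PowerSeries ℝ}

lemma value_ofReal (hF : ∀ n, 0 ≤ coeff n F) {z : ℝ} (hz : 0 ≤ z) :
    value F (ENNReal.ofReal z) = ∑' n, ENNReal.ofReal (coeff n F * z ^ n) :=
  tsum_congr fun n => by rw [ENNReal.ofReal_mul (hF n), ENNReal.ofReal_pow hz]

lemma summable_of_value_ne_top (hF : ∀ n, 0 ≤ coeff n F) {z : ℝ} (hz : 0 ≤ z)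
    (h : value F (ENNReal.ofReal z) ≠ ⊤) : Summable fun n => coeff n F * z ^ n := by
  rw [value_ofReal hF hz] at h
  refine (ENNReal.summable_toReal h).congr fun n => ?_
  rw [ENNReal.toReal_ofReal (mul_nonneg (hF n) (by positivity))]

lemma value_eq_ofReal_fn (hF : ∀ n, 0 ≤ coeff n F) {z : ℝ} (hz : 0 ≤ z)
    (h : Summable fun n => coeff n F * z ^ n) :
    value F (ENNReal.ofReal z) = ENNReal.ofReal (fn F z) := by
  rw [value_ofReal hF hz, fn, ENNReal.ofReal_tsum_of_nonneg
    (fun n => mul_nonneg (hF n) (by positivity)) h]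

lemma le_radius_of_value_ne_top (hF : ∀ n, 0 ≤ coeff n F) {z : ℝ} (hz : 0 ≤ z)
    (h : value F (ENNReal.ofReal z) ≠ ⊤) : ENNReal.ofReal z ≤ radius F := by
  refine FormalMultilinearSeries.le_radius_of_summable _ ?_
  refine (summable_of_value_ne_top hF hz h).congr fun n => ?_
  rw [FormalMultilinearSeries.ofScalars_norm, Real.norm_of_nonneg (hF n), Real.coe_toNNReal z hz]

lemma summable_mul_pow_of_lt_radius (hF : ∀ n, 0 ≤ coeff n F) {z : ℝ} (hz : 0 ≤ z)
    (h : ENNReal.ofReal z < radius F) (j : ℕ) :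
    Summable fun n => coeff n F * z ^ n * (n : ℝ) ^ j := by
  obtain ⟨s, hzs, hs⟩ := ENNReal.lt_iff_exists_nnreal_btwn.1 h
  obtain ⟨B, -, hB⟩ := FormalMultilinearSeries.norm_mul_pow_le_of_lt_radius _ hs
  have hzs' : z < s := by
    rwa [← ENNReal.ofReal_coe_nnreal, ENNReal.ofReal_lt_ofReal_iff_of_nonneg hz] at hzs
  have hs0 : (0 : ℝ) < s := hz.trans_lt hzs'
  have hg := summable_pow_mul_geometric_of_norm_lt_one j (r := z / s)
    (by rw [Real.norm_of_nonneg (by positivity), div_lt_one hs0]; exact hzs')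
  refine .of_nonneg_of_le (fun n => mul_nonneg (mul_nonneg (hF n) (by positivity)) (by positivity))
    (fun n => ?_) (hg.mul_left B)
  have := hB n
  rw [FormalMultilinearSeries.ofScalars_norm, Real.norm_of_nonneg (hF n)] at this
  calc _ = coeff n F * (s : ℝ) ^ n * ((n : ℝ) ^ j * (z / s) ^ n) := by
        rw [div_pow]; field_simp
    _ ≤ _ := by gcongr

lemma summable_of_lt_radius (hF : ∀ n, 0 ≤ coeff n F) {z : ℝ} (hz : 0 ≤ z)
    (h : ENNReal.ofReal z < radius F) : Summable fun n => coeff n F * z ^ n := by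
  simpa using summable_mul_pow_of_lt_radius hF hz h 0

lemma value_ne_top_of_lt_radius (hF : ∀ n, 0 ≤ coeff n F) {z : ℝ} (hz : 0 ≤ z)
    (h : ENNReal.ofReal z < radius F) : value F (ENNReal.ofReal z) ≠ ⊤ := by
  rw [value_eq_ofReal_fn hF hz (summable_of_lt_radius hF hz h)]
  exact ENNReal.ofReal_ne_top

lemma hasDerivAt_fn (hF : ∀ n, 0 ≤ coeff n F) {z : ℝ} (hz : z ∈ openInterval (radius F)) :
    HasDerivAt (fn F) (∑' n : ℕ, coeff n F * (n * z ^ (n - 1))) z := by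
  obtain ⟨s, hzs, hs⟩ := ENNReal.lt_iff_exists_nnreal_btwn.1 hz.2
  have hzs' : z < s := by
    rwa [← ENNReal.ofReal_coe_nnreal, ENNReal.ofReal_lt_ofReal_iff_of_nonneg hz.1.le] at hzs
  have hs0 : (0 : ℝ) < s := hz.1.trans hzs'
  rw [← ENNReal.ofReal_coe_nnreal] at hs
  have hu : Summable fun n : ℕ => coeff n F * (n * (s : ℝ) ^ (n - 1)) := by
    refine ((summable_mul_pow_of_lt_radius hF hs0.le hs 1).div_const (s : ℝ)).congr fun n => ?_
    cases n with
    | zero => simp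
    | succ n => rw [Nat.add_sub_cancel, pow_succ]; field_simp
  refine hasDerivAt_tsum_of_isPreconnected hu (t := Set.Ioo (-(s : ℝ)) s) isOpen_Ioo
    isPreconnected_Ioo (g := fun n t => coeff n F * t ^ n)
    (fun n t _ => (hasDerivAt_pow n t).const_mul _) (fun n t ht => ?_)
    (y₀ := z) ⟨by linarith [hz.1], hzs'⟩ (summable_of_lt_radius hF hz.1.le hz.2)
    ⟨by linarith [hz.1], hzs'⟩
  rw [norm_mul, norm_mul, norm_pow, Real.norm_of_nonneg (hF n), Real.norm_natCast]
  have := hF n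
  have ht' : ‖t‖ ≤ s := (abs_lt.2 ht).le
  gcongr

lemma summable_coeff_mul_sub_one (hF : ∀ n, 0 ≤ coeff n F) {z : ℝ}
    (hz : z ∈ openInterval (radius F)) : Summable fun n : ℕ => coeff n F * z ^ n * ((n : ℝ) - 1) := by
  refine ((summable_mul_pow_of_lt_radius hF hz.1.le hz.2 1).sub
    (summable_of_lt_radius hF hz.1.le hz.2)).congr fun n => by ring

/-- In this form, a zero of `A - z A'` says that the law tilted at `z` has mean 1. -/
lemma charFn_eq (hF : ∀ n, 0 ≤ coeff n F) {z : ℝ} (hz : z ∈ openInterval (radius F)) :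
    charFn F z = -∑' n : ℕ, coeff n F * z ^ n * ((n : ℝ) - 1) := by
  rw [charFn, (hasDerivAt_fn hF hz).deriv, fn, ← tsum_mul_left, ← tsum_neg,
    ← (summable_of_lt_radius hF hz.1.le hz.2).tsum_sub]
  · refine tsum_congr fun n => ?_
    cases n with
    | zero => simp
    | succ n => rw [Nat.add_sub_cancel, pow_succ]; ring
  · refine (summable_mul_pow_of_lt_radius hF hz.1.le hz.2 1).congr fun n => ?_
    cases n with
    | zero => simp
    | succ n => rw [Nat.add_sub_cancel, pow_succ]; ring

end Radius

/-! ### The critical point of `z / A(z)`. -/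

section CharacteristicEquation

variable {A : PowerSeries ℝ}

lemma fn_pos (hA : ∀ n, 0 ≤ coeff n A) (hA0 : constantCoeff A = 1) {z : ℝ} (hz : 0 ≤ z)
    (h : Summable fun n => coeff n A * z ^ n) : 0 < fn A z :=
  h.tsum_pos (fun n => mul_nonneg (hA n) (by positivity)) 0 (by simp [hA0])

/-- Rolle's theorem for `z / A(z)`. -/
lemma exists_charFn_eq_zero (hA : ∀ n, 0 ≤ coeff n A) (hA0 : constantCoeff A = 1) {w z : ℝ}
    (hw : 0 < w) (hwz : w < z) (hz : ENNReal.ofReal z < radius A)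
    (h : w / fn A w = z / fn A z) : ∃ c ∈ Set.Ioo w z, charFn A c = 0 := by
  have hmem : ∀ t ∈ Set.Icc w z, t ∈ openInterval (radius A) := fun t ht =>
    ⟨hw.trans_le ht.1, (ENNReal.ofReal_le_ofReal ht.2).trans_lt hz⟩
  have hpos : ∀ t ∈ Set.Icc w z, fn A t ≠ 0 := fun t ht =>
    (fn_pos hA hA0 (hmem t ht).1.le (summable_of_lt_radius hA (hmem t ht).1.le (hmem t ht).2)).ne'
  have hd : ∀ t ∈ Set.Icc w z, HasDerivAt (fun t => t / fn A t) (charFn A t / fn A t ^ 2) t := by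
    intro t ht
    have h1 := hasDerivAt_fn hA (hmem t ht)
    have h2 := (hasDerivAt_id' t).fun_div h1 (hpos t ht)
    rw [charFn, h1.deriv]
    simpa using h2
  obtain ⟨c, hc, hc0⟩ := exists_hasDerivAt_eq_zero hwz
    (fun t ht => (hd t ht).continuousAt.continuousWithinAt) h
    (fun t ht => hd t (Set.Ioo_subset_Icc_self ht))
  exact ⟨c, hc, by simpa [hpos c (Set.Ioo_subset_Icc_self hc)] using hc0⟩

/-- Each `(n - 1) a_n z^n` is non-decreasing in `z`, so two zeros would force `a_n = 0` for `n ≥ 2`;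
but then `A - z A' = 1`. -/
lemma charFn_zero_unique (hA : ∀ n, 0 ≤ coeff n A) (hA0 : constantCoeff A = 1) {w z : ℝ}
    (hw : w ∈ openInterval (radius A)) (hz : z ∈ openInterval (radius A))
    (hw0 : charFn A w = 0) (hz0 : charFn A z = 0) : w = z := by
  wlog hwz : w ≤ z generalizing w z
  · exact (this hz hw hz0 hw0 (not_le.1 hwz).le).symm
  by_contra hne
  have hlt : w < z := lt_of_le_of_ne hwz hne
  rw [charFn_eq hA hw, neg_eq_zero] at hw0
  rw [charFn_eq hA hz, neg_eq_zero] at hz0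
  have hs := (summable_coeff_mul_sub_one hA hz).hasSum.sub (summable_coeff_mul_sub_one hA hw).hasSum
  rw [hw0, hz0, sub_zero, hasSum_zero_iff_of_nonneg] at hs
  · have h2 : ∀ n, 2 ≤ n → coeff n A = 0 := fun n hn => by
      have h3 := congrFun hs n
      have h4 : w ^ n < z ^ n := pow_lt_pow_left₀ hlt hw.1.le (by omega)
      have h5 : (1 : ℝ) < n := by exact_mod_cast hn
      have h6 : coeff n A * ((z ^ n - w ^ n) * ((n : ℝ) - 1)) = 0 := by
        rw [← show _ = (0 : ℝ) from h3]; ring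
      exact (mul_eq_zero.1 h6).resolve_right (mul_pos (by linarith) (by linarith)).ne'
    rw [tsum_eq_single 0] at hw0
    · simp [hA0] at hw0
    · intro n hn
      obtain rfl | hn' : n = 1 ∨ 2 ≤ n := by omega
      · simp
      · simp [h2 n hn']
  · intro n
    have : coeff n A * z ^ n * ((n : ℝ) - 1) - coeff n A * w ^ n * ((n : ℝ) - 1)
        = coeff n A * ((z ^ n - w ^ n) * ((n : ℝ) - 1)) := by ring
    refine le_of_le_of_eq ?_ this.symm
    refine mul_nonneg (hA n) ?_
    rcases Nat.eq_zero_or_pos n with rfl | hn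
    · simp
    · exact mul_nonneg (sub_nonneg.2 (pow_le_pow_left₀ hw.1.le hwz n))
        (sub_nonneg.2 (by exact_mod_cast hn))

/-- The tangent to the graph of `A` at a zero `τ` of `A - z A'` passes through the origin, and the
graph lies above it. -/
lemma mul_fn_le_of_charFn_eq_zero (hA : ∀ n, 0 ≤ coeff n A) {τ w : ℝ}
    (hτ : τ ∈ openInterval (radius A)) (hτ0 : charFn A τ = 0) (hw : 0 ≤ w)
    (hs : Summable fun n => coeff n A * w ^ n) : w * fn A τ ≤ τ * fn A w := by
  rw [charFn_eq hA hτ, neg_eq_zero] at hτ0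
  have h1 : HasSum (fun n : ℕ => coeff n A * τ ^ n * ((n : ℝ) - 1)) 0 :=
    hτ0 ▸ (summable_coeff_mul_sub_one hA hτ).hasSum
  have h2 : HasSum (fun n => coeff n A * τ ^ n) (fn A τ) :=
    (summable_of_lt_radius hA hτ.1.le hτ.2).hasSum
  have h3 := (h2.mul_left w).add (h1.mul_left (w - τ))
  rw [mul_zero, add_zero] at h3
  refine hasSum_le (fun n => ?_) h3 (hs.hasSum.mul_left τ)
  -- Bernoulli's inequality puts each monomial above its tangent at `τ`; `h3` sums these tangents.
  have hb : 1 + (n : ℝ) * (w / τ - 1) ≤ (w / τ) ^ n := by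
    have := one_add_mul_le_pow (a := w / τ - 1) (by have := div_nonneg hw hτ.1.le; linarith) n
    simpa using this
  have hτ1 := hτ.1
  have hb' : τ ^ n * (τ + n * (w - τ)) ≤ τ * w ^ n := by
    calc _ = τ * τ ^ n * (1 + (n : ℝ) * (w / τ - 1)) := by field_simp
      _ ≤ τ * τ ^ n * (w / τ) ^ n := by gcongr
      _ = _ := by rw [div_pow]; field_simp
  calc _ = coeff n A * (τ ^ n * (τ + n * (w - τ))) := by ring
    _ ≤ coeff n A * (τ * w ^ n) := mul_le_mul_of_nonneg_left hb' (hA n)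
    _ = _ := by ring

end CharacteristicEquation

/-! ### Radius, boundary value and asymptotics of the solution. -/

section Solution

variable {A y : PowerSeries ℝ}

lemma value_solution_zero (hy0 : constantCoeff y = 0) (hAy : y = (X : PowerSeries ℝ) * A.subst y)
    (hA : ∀ n, 0 ≤ coeff n A) : value y 0 = 0 := by
  rw [value_solution hy0 hAy hA, zero_mul]

/-- If `A` diverged at `y(x)`, then `y(x) = x A(y(x))` would be infinite. -/
lemma solution_eq (hA0 : constantCoeff A = 1) (hy0 : constantCoeff y = 0)
    (hAy : y = (X : PowerSeries ℝ) * A.subst y) (hA : ∀ n, 0 ≤ coeff n A) {x w : ℝ} (hx : 0 < x)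
    (hw : 0 ≤ w) (h : value y (ENNReal.ofReal x) = ENNReal.ofReal w) :
    (value A (ENNReal.ofReal w) ≠ ⊤) ∧ (Summable fun n => coeff n A * w ^ n) ∧ 0 < w ∧
      w / fn A w = x := by
  have heq := value_solution hy0 hAy hA (ENNReal.ofReal x)
  rw [h] at heq
  have hne : value A (ENNReal.ofReal w) ≠ ⊤ := fun htop => by
    rw [htop, ENNReal.mul_top (ENNReal.ofReal_pos.2 hx).ne'] at heq
    exact ENNReal.ofReal_ne_top heq
  have hs := summable_of_value_ne_top hA hw hne
  have hpos := fn_pos hA hA0 hw hs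
  rw [value_eq_ofReal_fn hA hw hs, ← ENNReal.ofReal_mul hx.le,
    ENNReal.ofReal_eq_ofReal_iff hw (by positivity)] at heq
  refine ⟨hne, hs, heq ▸ mul_pos hx hpos, ?_⟩
  rw [div_eq_iff hpos.ne', ← heq]

/-- If `y(r) > R`, some finite partial sum exceeds `R` already at a `t < r`; but `y(t)` is finite,
so `A` converges there and `y(t) ≤ R`. -/
lemma value_radius_solution_le (hA0 : constantCoeff A = 1) (hy0 : constantCoeff y = 0)
    (hAy : y = (X : PowerSeries ℝ) * A.subst y) (hA : ∀ n, 0 ≤ coeff n A) :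
    value y (radius y) ≤ radius A := by
  have hy := coeff_solution_nonneg hy0 hAy hA
  by_contra! h
  rcases eq_or_ne (radius y) 0 with hr | hr
  · rw [hr, value_solution_zero hy0 hAy hA] at h
    exact not_lt_zero h
  unfold value at h
  rw [ENNReal.tsum_eq_iSup_sum, lt_iSup_iff] at h
  obtain ⟨s, hs⟩ := h
  have hc : Continuous fun t : ℝ≥0∞ => ∑ n ∈ s, ENNReal.ofReal (coeff n y) * t ^ n :=
    continuous_finsetSum _ fun n _ =>
      (ENNReal.continuous_const_mul ENNReal.ofReal_ne_top).comp (ENNReal.continuous_pow n)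
  have hev : ∀ᶠ t in 𝓝[<] (radius y), radius A < ∑ n ∈ s, ENNReal.ofReal (coeff n y) * t ^ n :=
    nhdsWithin_le_nhds (hc.continuousAt.eventually_const_lt hs)
  have := nhdsLT_neBot_of_exists_lt ⟨0, pos_iff_ne_zero.2 hr⟩
  obtain ⟨t, ht, htr⟩ := (hev.and self_mem_nhdsWithin).exists
  have htr' : t < radius y := htr
  have ht' : radius A < value y t := ht.trans_le (ENNReal.sum_le_tsum _)
  obtain ⟨x, hx0, rfl⟩ : ∃ x : ℝ, 0 ≤ x ∧ t = ENNReal.ofReal x :=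
    ⟨t.toReal, ENNReal.toReal_nonneg, (ENNReal.ofReal_toReal htr'.ne_top).symm⟩
  have hx : 0 < x := by
    refine lt_of_le_of_ne hx0 fun hx => ?_
    rw [← hx, ENNReal.ofReal_zero, value_solution_zero hy0 hAy hA] at ht'
    exact not_lt_zero ht'
  have hfin := value_ne_top_of_lt_radius hy hx0 htr'
  have hval := (ENNReal.ofReal_toReal hfin).symm
  have hsol := solution_eq hA0 hy0 hAy hA hx ENNReal.toReal_nonneg hval
  have := le_radius_of_value_ne_top hA ENNReal.toReal_nonneg hsol.1
  rw [← hval] at this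
  exact absurd ht' this.not_gt

/-- With `x = z / A(z)`, `z` solves the equation and so bounds the least solution `w`; `w < z` is
not yet excluded. -/
lemma exists_value_solution_eq (hA0 : constantCoeff A = 1) (hy0 : constantCoeff y = 0)
    (hAy : y = (X : PowerSeries ℝ) * A.subst y) (hA : ∀ n, 0 ≤ coeff n A) {z : ℝ}
    (hz : z ∈ openInterval (radius A)) :
    ENNReal.ofReal (z / fn A z) ≤ radius y ∧ ∃ w, 0 < w ∧ w ≤ z ∧
      value y (ENNReal.ofReal (z / fn A z)) = ENNReal.ofReal w ∧ w / fn A w = z / fn A z := by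
  have hy := coeff_solution_nonneg hy0 hAy hA
  have hs := summable_of_lt_radius hA hz.1.le hz.2
  have hpos := fn_pos hA hA0 hz.1.le hs
  have hx : 0 < z / fn A z := div_pos hz.1 hpos
  have hle : value y (ENNReal.ofReal (z / fn A z)) ≤ ENNReal.ofReal z := by
    refine value_solution_le hy0 hAy hA ?_
    rw [value_eq_ofReal_fn hA hz.1.le hs, ← ENNReal.ofReal_mul hx.le, div_mul_cancel₀ _ hpos.ne']
  have hfin := ne_top_of_le_ne_top ENNReal.ofReal_ne_top hle
  have hval := (ENNReal.ofReal_toReal hfin).symm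
  have hsol := solution_eq hA0 hy0 hAy hA hx ENNReal.toReal_nonneg hval
  exact ⟨le_radius_of_value_ne_top hy hx.le hfin, _, hsol.2.2.1,
    ENNReal.toReal_le_of_le_ofReal hz.1.le hle, hval, hsol.2.2.2⟩

lemma radius_le_value_radius_solution (hA0 : constantCoeff A = 1) (hy0 : constantCoeff y = 0)
    (hAy : y = (X : PowerSeries ℝ) * A.subst y) (hA : ∀ n, 0 ≤ coeff n A)
    (h : ∀ z ∈ openInterval (radius A), charFn A z ≠ 0) : radius A ≤ value y (radius y) := by
  refine ENNReal.le_of_forall_nnreal_lt fun z hz => ?_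
  rcases eq_or_ne z 0 with rfl | hz0
  · simp
  rw [← ENNReal.ofReal_coe_nnreal] at hz ⊢
  have hz1 : (0 : ℝ) < z := by positivity
  obtain ⟨hr, w, hw, hwz, hval, heq⟩ := exists_value_solution_eq hA0 hy0 hAy hA ⟨hz1, hz⟩
  rcases hwz.lt_or_eq with hlt | rfl
  · obtain ⟨c, hc, hc0⟩ := exists_charFn_eq_zero hA hA0 hw hlt hz heq
    exact absurd hc0 (h c ⟨hw.trans hc.1, (ENNReal.ofReal_le_ofReal hc.2.le).trans_lt hz⟩)
  · rw [← hval]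
    exact value_mono hr

/-- `y` converges at `τ / A(τ)`; and each `x < r` equals `w / A(w)` for `w = y(x)`, which the
tangent inequality bounds by `τ / A(τ)`. -/
lemma radius_solution_eq (hA0 : constantCoeff A = 1) (hy0 : constantCoeff y = 0)
    (hAy : y = (X : PowerSeries ℝ) * A.subst y) (hA : ∀ n, 0 ≤ coeff n A) {τ : ℝ}
    (hτ : τ ∈ openInterval (radius A)) (hτ0 : charFn A τ = 0) :
    radius y = ENNReal.ofReal (τ / fn A τ) := by
  have hy := coeff_solution_nonneg hy0 hAy hA
  have hpos := fn_pos hA hA0 hτ.1.le (summable_of_lt_radius hA hτ.1.le hτ.2)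
  refine le_antisymm (ENNReal.le_of_forall_nnreal_lt fun x hx => ?_)
    (exists_value_solution_eq hA0 hy0 hAy hA hτ).1
  rcases eq_or_ne x 0 with rfl | hx0
  · simp
  rw [← ENNReal.ofReal_coe_nnreal] at hx ⊢
  have hx1 : (0 : ℝ) < x := by positivity
  have hval := (ENNReal.ofReal_toReal (value_ne_top_of_lt_radius hy hx1.le hx)).symm
  obtain ⟨-, hs, hw, hwx⟩ := solution_eq hA0 hy0 hAy hA hx1 ENNReal.toReal_nonneg hval
  refine ENNReal.ofReal_le_ofReal ?_
  rw [← hwx, div_le_div_iff₀ (fn_pos hA hA0 hw.le hs) hpos]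
  exact mul_fn_le_of_charFn_eq_zero hA hτ hτ0 hw.le hs

lemma value_radius_solution_eq (hA0 : constantCoeff A = 1) (hy0 : constantCoeff y = 0)
    (hAy : y = (X : PowerSeries ℝ) * A.subst y) (hA : ∀ n, 0 ≤ coeff n A) {τ : ℝ}
    (hτ : τ ∈ openInterval (radius A)) (hτ0 : charFn A τ = 0) :
    value y (radius y) = ENNReal.ofReal τ := by
  rw [radius_solution_eq hA0 hy0 hAy hA hτ hτ0]
  obtain ⟨-, w, hw, hwz, hval, heq⟩ := exists_value_solution_eq hA0 hy0 hAy hA hτ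
  rcases hwz.lt_or_eq with hlt | rfl
  · obtain ⟨c, hc, hc0⟩ := exists_charFn_eq_zero hA hA0 hw hlt hτ.2 heq
    have hcmem : c ∈ openInterval (radius A) :=
      ⟨hw.trans hc.1, (ENNReal.ofReal_le_ofReal hc.2.le).trans_lt hτ.2⟩
    exact absurd (charFn_zero_unique hA hA0 hcmem hτ hc0 hτ0) hc.2.ne
  · exact hval

lemma coeff_solution_isEquivalent (hA0 : constantCoeff A = 1) (hy0 : constantCoeff y = 0)
    (hAy : y = (X : PowerSeries ℝ) * A.subst y) (hA : ∀ n, 0 ≤ coeff n A)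
    (hgcd : Nat.setGcd {n : ℕ | 1 ≤ n ∧ 0 < coeff n A} = 1) {τ : ℝ}
    (hτ : τ ∈ openInterval (radius A)) (hτ0 : charFn A τ = 0) :
    ∃ C : ℝ, 0 < C ∧ (fun n : ℕ => coeff n y) ~[atTop]
      (fun n : ℕ => C * ((radius y).toReal ^ n)⁻¹ * (n : ℝ) ^ (-(3 / 2) : ℝ)) := by
  have hs := summable_of_lt_radius hA hτ.1.le hτ.2
  have hpos := fn_pos hA hA0 hτ.1.le hs
  have hτ1 := hτ.1
  have hmean := hτ0
  rw [charFn_eq hA hτ, neg_eq_zero] at hmean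
  obtain ⟨L, hL, hlim⟩ := tendsto_sqrt_mul_coeff_pow hA (by simp [hA0]) hgcd hτ.1 hs
    (summable_mul_pow_of_lt_radius hA hτ.1.le hτ.2 3) hmean
  -- The factor `τ` comes from `A(τ)^n / τ^(n-1) = τ r^(-n)`.
  refine ⟨τ * L, mul_pos hτ.1 hL, ?_⟩
  rw [radius_solution_eq hA0 hy0 hAy hA hτ hτ0, ENNReal.toReal_ofReal (by positivity)]
  refine (isEquivalent_iff_tendsto_one ?_).2 ?_
  · filter_upwards [eventually_gt_atTop 0] with n hn
    positivity
  · have h1 := hlim.div_const L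
    rw [div_self hL.ne'] at h1
    refine h1.congr' ?_
    filter_upwards [eventually_gt_atTop 0] with n hn
    obtain ⟨m, rfl⟩ : ∃ m, n = m + 1 := ⟨n - 1, by omega⟩
    have hm : (0 : ℝ) < ((m + 1 : ℕ) : ℝ) := by positivity
    have hpow : ((m + 1 : ℕ) : ℝ) ^ (-(3 / 2) : ℝ) =
        (((m + 1 : ℕ) : ℝ) * √((m + 1 : ℕ) : ℝ))⁻¹ := by
      rw [Real.rpow_neg hm.le, Real.sqrt_eq_rpow, show (3 / 2 : ℝ) = 1 + 1 / 2 by norm_num,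
        Real.rpow_add hm, Real.rpow_one]
    rw [Pi.div_apply, coeff_solution hy0 hAy, hpow, Nat.add_sub_cancel, div_pow, pow_succ τ,
      ← Nat.cast_succ]
    field_simp

end Solution

end TreeSeries

end

theorem theorem4 (A y : PowerSeries ℝ)
    (hA0 : constantCoeff A = 1)
    (hy0 : constantCoeff y = 0)
    (hR : 0 < TreeSeries.radius A)
    (hA : ∀ n : ℕ, 1 ≤ n → 0 ≤ coeff n A)
    (hAy : y = (X : PowerSeries ℝ) * A.subst y)
    (hgcd : Nat.setGcd {n : ℕ | 1 ≤ n ∧ 0 < coeff n A} = 1) :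
    Xor
      ((∀ z ∈ TreeSeries.openInterval (TreeSeries.radius A), TreeSeries.charFn A z ≠ 0) ∧
        TreeSeries.radius A = TreeSeries.value y (TreeSeries.radius y))
      (∃ τ ∈ TreeSeries.openInterval (TreeSeries.radius A),
        (∀ z ∈ TreeSeries.openInterval (TreeSeries.radius A),
          TreeSeries.charFn A z = 0 ↔ z = τ) ∧
        TreeSeries.value y (TreeSeries.radius y) = ENNReal.ofReal τ ∧
        TreeSeries.value y (TreeSeries.radius y) < TreeSeries.radius A ∧
        ∃ C : ℝ, 0 < C ∧
          (fun n : ℕ => coeff n y) ~[atTop]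
            (fun n : ℕ => C * ((TreeSeries.radius y).toReal ^ n)⁻¹ * (n : ℝ) ^ (-(3 / 2) : ℝ))) := by
  have hA' : ∀ n, 0 ≤ coeff n A := fun n => by
    rcases Nat.eq_zero_or_pos n with rfl | hn
    · simp [hA0]
    · exact hA n hn
  by_cases h : ∀ z ∈ TreeSeries.openInterval (TreeSeries.radius A), TreeSeries.charFn A z ≠ 0
  · refine Or.inl ⟨⟨h, le_antisymm
      (TreeSeries.radius_le_value_radius_solution hA0 hy0 hAy hA' h)
      (TreeSeries.value_radius_solution_le hA0 hy0 hAy hA')⟩, ?_⟩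
    rintro ⟨τ, hτ, huniq, -⟩
    exact h τ hτ ((huniq τ hτ).2 rfl)
  · refine Or.inr ⟨?_, fun h' => h h'.1⟩
    push Not at h
    obtain ⟨τ, hτ, hτ0⟩ := h
    have hval := TreeSeries.value_radius_solution_eq hA0 hy0 hAy hA' hτ hτ0
    exact ⟨τ, hτ, fun z hz =>
      ⟨fun hz0 => TreeSeries.charFn_zero_unique hA' hA0 hz hτ hz0 hτ0, fun hz0 => hz0 ▸ hτ0⟩,
      hval, hval ▸ hτ.2,
      TreeSeries.coeff_solution_isEquivalent hA0 hy0 hAy hA' hgcd hτ hτ0⟩
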